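/- For a finite bounded graded poset $P$ with rank function $\rho$, least element $\widehat 0$, greatest element $\widehat 1$ and Möbius function $\mu$, put $\chi_{[x,y]}(t)=\sum_{x\le z\le y}\mu(x,z)\,t^{\rho(y)-\rho(z)}$ for $x\le y$ in $P$, and let $\overline\chi_{[x,x]}(t)=-1$ and $\overline\chi_{[x,y]}(t)=\chi_{[x,y]}(t)/(t-1)$ for $x<y$ (a polynomial). The Chow function $\mathrm H$ of $P$ is the inverse of $-\overline\chi$ in the incidence algebra of $P$ over $\mathbb Z[t]$, that is, $\mathrm H_{[x,x]}(t)=1$ and $\mathrm H_{[x,y]}(t)=\sum_{x<z\le y}\overline\chi_{[x,z]}(t)\,\mathrm H_{[z,y]}(t)$ for $x<y$; the Chow polynomial of $P$ is $\mathrm H_P(t)=\mathrm H_{[\widehat 0,\widehat 1]}(t)\in\mathbb Z[t]$. The truncation $\tau(P)$ of $P$ is the poset obtained from $P$ by removing all its coatoms, i.e. the elements covered by $\widehat 1$. For integers $0\le k\le n$, the uniform geometric lattice $\mathsf U_{k,n}=\tau^{\,n-k}(\mathsf B_n)$ of rank $k$ on $n$ elements is obtained by truncating $n-k$ times the Boolean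 algebra $\mathsf B_n$ of all subsets of $\{1,\dots,n\}$ ordered by inclusion. **Theorem.** For all integers $0\le k\le n$, all complex zeros of the Chow polynomial $\mathrm H_{\mathsf U_{k,n}}(t)$ are real. -/

import Mathlib

noncomputable section

namespace ChowPoly

open Polynomial

/-! ### The Chow polynomial of a bounded graded poset -/

section Chow

variable {P : Type*} [PartialOrder P] [LocallyFiniteOrder P] [DecidableEq P] [GradeMinOrder ℕ P]

/-- The characteristic function `χ_{[x,y]}(t) = ∑_{x ≤ z ≤ y} μ(x,z) t^{ρ(y) - ρ(z)}`. -/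
def charFun : IncidenceAlgebra ℤ[X] P where
  toFun x y := ∑ z ∈ Finset.Icc x y,
    C (IncidenceAlgebra.mu ℤ x z) * X ^ (grade ℕ y - grade ℕ z)
  eq_zero_of_not_le' x y h := by simp [Finset.Icc_eq_empty h]

/-- On nontrivial intervals `χ` is divisible by `t - 1`, so the division below is exact. -/
theorem X_sub_one_dvd_charFun {x y : P} (h : x ≠ y) :
    (X - C 1 : ℤ[X]) ∣ charFun x y := by
  rw [dvd_iff_isRoot, IsRoot.def]
  change eval 1 (∑ z ∈ Finset.Icc x y,
    C (IncidenceAlgebra.mu ℤ x z) * X ^ (grade ℕ y - grade ℕ z)) = 0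
  simp [eval_finsetSum, IncidenceAlgebra.sum_Icc_mu_right, h]

/-- The reduced characteristic function: `-1` on trivial intervals, `χ / (t - 1)` otherwise. -/
def redCharFun : IncidenceAlgebra ℤ[X] P where
  toFun x y := if x = y then -1 else charFun x y /ₘ (X - C 1)
  eq_zero_of_not_le' x y h := by
    have hne : x ≠ y := fun e => h e.le
    simp [hne, IncidenceAlgebra.apply_eq_zero_of_not_le h]

/-- The recursion computing the inverse of `-redCharFun` in the incidence algebra. -/
def chowFun (y x : P) : ℤ[X] :=
  if x = y then 1
  else ∑ z ∈ (Finset.Ioc x y).attach, redCharFun x z.1 * chowFun y z.1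
termination_by (Finset.Icc x y).card
decreasing_by
  have h := Finset.mem_Ioc.1 z.2
  exact Finset.card_lt_card (Finset.Icc_ssubset_Icc_left (h.1.le.trans h.2) h.1 le_rfl)

/-- The Chow function `H = (-redCharFun)⁻¹`, i.e. `H_{[x,x]} = 1` and
`H_{[x,y]} = ∑_{x < z ≤ y} redCharFun_{[x,z]} H_{[z,y]}` for `x < y`. -/
def chow : IncidenceAlgebra ℤ[X] P where
  toFun x y := chowFun y x
  eq_zero_of_not_le' x y h := by
    have hne : x ≠ y := fun e => h e.le
    have he : Finset.Ioc x y = ∅ := Finset.Ioc_eq_empty fun hlt => h hlt.le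
    rw [chowFun, if_neg hne, Finset.sum_attach (Finset.Ioc x y)
      (fun z => redCharFun x z * chowFun y z), he, Finset.sum_empty]

theorem chow_apply (x y : P) :
    chow x y = if x = y then 1 else ∑ z ∈ Finset.Ioc x y, redCharFun x z * chow z y := by
  change chowFun y x = if x = y then 1 else ∑ z ∈ Finset.Ioc x y, redCharFun x z * chowFun y z
  rw [chowFun, Finset.sum_attach (Finset.Ioc x y) (fun z => redCharFun x z * chowFun y z)]

/-- `chow` is indeed the inverse of `-redCharFun`. -/
theorem neg_redCharFun_mul_chow : (-redCharFun * chow : IncidenceAlgebra ℤ[X] P) = 1 := by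
  ext1 x y hxy
  have hd : (redCharFun x x : ℤ[X]) = -1 := if_pos rfl
  rw [IncidenceAlgebra.mul_apply, Finset.Icc_eq_cons_Ioc hxy, Finset.sum_cons,
    IncidenceAlgebra.one_apply]
  simp only [IncidenceAlgebra.neg_apply, hd, neg_neg, one_mul, neg_mul, Finset.sum_neg_distrib]
  rw [chow_apply]
  split_ifs with h
  · subst h; simp
  · ring

end Chow

/-- The Chow polynomial `H_P(t) = H_{[0̂,1̂]}(t)` of a bounded graded poset. -/
def chowPolynomial (P : Type*) [PartialOrder P] [BoundedOrder P] [LocallyFiniteOrder P]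
    [DecidableEq P] [GradeMinOrder ℕ P] : ℤ[X] :=
  chow (⊥ : P) (⊤ : P)

/-! ### Uniform geometric lattices -/

/-- The truncation of a subposet `S` (with greatest element): all its coatoms, i.e. the elements
covered in `S` by the greatest element of `S`, are removed. -/
def truncation {α : Type*} [PartialOrder α] (S : Set α) : Set α :=
  {x | ∃ hx : x ∈ S, ∀ (m : α) (hm : IsGreatest S m), ¬ ((⟨x, hx⟩ : S) ⋖ ⟨m, hm.1⟩)}

/-- The Boolean algebra of all subsets of an `n`-element set, truncated `n - k` times. -/
def uniformSet (k n : ℕ) : Set (Finset (Fin n)) := truncation^[n - k] Set.univ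

/-- The uniform geometric lattice `U_{k,n}` (meaningful for `k ≤ n`), ordered by inclusion. -/
abbrev UniformLattice (k n : ℕ) : Type := uniformSet k n

theorem mem_truncation_iter {n : ℕ} (i : ℕ) (A : Finset (Fin n)) :
    A ∈ truncation^[i] (Set.univ : Set (Finset (Fin n))) ↔ A.card < n - i ∨ A = Finset.univ := by
  induction i generalizing A with
  | zero =>
    have h := A.card_le_univ
    have h2 := A.card_eq_iff_eq_univ
    simp only [Fintype.card_fin] at h h2
    simp only [Function.iterate_zero, id, Set.mem_univ, Nat.sub_zero, true_iff, ← h2]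
    omega
  | succ i ih =>
    rw [Function.iterate_succ_apply']
    set S := truncation^[i] (Set.univ : Set (Finset (Fin n))) with hS
    have hU : IsGreatest S Finset.univ := ⟨(ih _).2 (Or.inr rfl), fun B _ => Finset.subset_univ B⟩
    constructor
    · rintro ⟨hA, hc⟩
      by_contra! hcon
      obtain ⟨h1, h2⟩ := hcon
      refine hc _ hU ⟨lt_of_le_of_ne (Finset.subset_univ A) (fun e => h2 (congrArg Subtype.val e)),
        fun B hAB hB => ?_⟩
      have h3 : A.card < B.1.card := Finset.card_lt_card hAB
      rcases (ih _).1 B.2 with h4 | h4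
      · omega
      · exact hB.ne (Subtype.ext h4)
    · rintro (h | rfl)
      · have hA : A ∈ S := (ih _).2 (Or.inl (by omega))
        refine ⟨hA, fun m hm hcov => ?_⟩
        obtain rfl := hm.unique hU
        have hne : A ≠ Finset.univ := fun e => hcov.lt.ne (Subtype.ext e)
        obtain ⟨a, ha⟩ : ∃ a, a ∉ A := by
          by_contra! hh
          exact hne (Finset.eq_univ_iff_forall.2 hh)
        have hcard : (insert a A).card = A.card + 1 := Finset.card_insert_of_notMem ha
        have hB : insert a A ∈ S := (ih _).2 (Or.inl (by omega))
        have hBU : insert a A ≠ Finset.univ := fun e => by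
          rw [e, Finset.card_univ, Fintype.card_fin] at hcard
          omega
        exact hcov.2 (c := ⟨insert a A, hB⟩) (Finset.ssubset_insert ha)
          (lt_of_le_of_ne (Finset.subset_univ _) (fun e => hBU (congrArg Subtype.val e)))
      · refine ⟨hU.1, fun m hm hcov => ?_⟩
        obtain rfl := hm.unique hU
        exact hcov.lt.ne rfl

theorem mem_uniformSet {k n : ℕ} {A : Finset (Fin n)} :
    A ∈ uniformSet k n ↔ A.card < min k n ∨ A = Finset.univ := by
  rw [uniformSet, mem_truncation_iter, show n - (n - k) = min k n by omega]

instance (k n : ℕ) : DecidablePred (· ∈ uniformSet k n) := fun _ =>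
  decidable_of_iff _ mem_uniformSet.symm

/-- The greatest element is the whole set; the least element is the empty set, except that
`U_{0,n}` is the one-point poset. -/
instance (k n : ℕ) : BoundedOrder (UniformLattice k n) where
  top := ⟨Finset.univ, mem_uniformSet.2 (Or.inr rfl)⟩
  le_top A := Finset.subset_univ A.1
  bot := if h : 0 < min k n then ⟨∅, mem_uniformSet.2 (Or.inl (by simpa using h))⟩
    else ⟨Finset.univ, mem_uniformSet.2 (Or.inr rfl)⟩
  bot_le A := by
    split_ifs with h
    · exact Finset.empty_subset A.1
    · rcases mem_uniformSet.1 A.2 with h1 | h1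
      · omega
      · exact h1.ge

/-- The rank function of `U_{k,n}`: proper members have their cardinality as rank, and the
greatest element has rank `k` (when `k ≤ n`). -/
instance (k n : ℕ) : GradeMinOrder ℕ (UniformLattice k n) where
  grade A := if A.1 = Finset.univ then min k n else A.1.card
  grade_strictMono A B hAB := by
    have hA : A.1 ≠ Finset.univ := fun e =>
      hAB.not_ge (show B.1 ⊆ A.1 from e ▸ Finset.subset_univ B.1)
    have hA' := (mem_uniformSet.1 A.2).resolve_right hA
    have hc : A.1.card < B.1.card := Finset.card_lt_card hAB
    simp only [hA, if_false]
    split_ifs <;> assumption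
  covBy_grade A B hAB := by
    have hlt := hAB.lt
    have hA : A.1 ≠ Finset.univ := fun e =>
      hlt.not_ge (show B.1 ⊆ A.1 from e ▸ Finset.subset_univ B.1)
    have hA' := (mem_uniformSet.1 A.2).resolve_right hA
    have hAB' : A.1 ⊂ B.1 := hlt
    have hc : A.1.card < B.1.card := Finset.card_lt_card hAB'
    obtain ⟨a, haB, haA⟩ := Finset.exists_of_ssubset hAB'
    have hcard : (insert a A.1).card = A.1.card + 1 := Finset.card_insert_of_notMem haA
    have hsub : insert a A.1 ⊆ B.1 := Finset.insert_subset haB hAB'.1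
    have key : insert a A.1 ∈ uniformSet k n → insert a A.1 = B.1 := fun hm => by
      by_contra hne
      exact hAB.2 (c := ⟨insert a A.1, hm⟩) (Finset.ssubset_insert haA)
        (lt_of_le_of_ne hsub fun e => hne (congrArg Subtype.val e))
    simp only [hA, if_false, Nat.covBy_iff_add_one_eq]
    split_ifs with hB
    · by_contra hne
      have h1 := key (mem_uniformSet.2 (Or.inl (by omega)))
      rw [h1, hB, Finset.card_univ, Fintype.card_fin] at hcard
      omega
    · have hB' := (mem_uniformSet.1 B.2).resolve_right hB
      rw [← key (mem_uniformSet.2 (Or.inl (by omega))), hcard]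
  isMin_grade A hA := by
    rw [isMin_iff_eq_bot]
    by_cases h : 0 < min k n
    · have h1 : A.1 = ∅ := Finset.subset_empty.1
        (hA (b := ⟨∅, mem_uniformSet.2 (Or.inl (by simpa using h))⟩) (Finset.empty_subset A.1))
      have h2 : (∅ : Finset (Fin n)) ≠ Finset.univ := fun e => by
        have := congrArg Finset.card e
        simp only [Finset.card_empty, Finset.card_univ, Fintype.card_fin] at this
        omega
      simp [h1, h2]
    · have h1 : A.1 = Finset.univ := (mem_uniformSet.1 A.2).resolve_left (by omega)
      simp only [h1, if_true, Nat.bot_eq_zero]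
      omega

end ChowPoly

end

/-! Write `[r] = 1 + z + ⋯ + z^(r-1)` and let `d_s` be the derangement polynomials. At a point `z ≠
1` the Chow polynomial of `U_{k,n}`, for `0 < k ≤ n`, takes the value `∑_{s<k} (n choose s) d_s
[k-s]`, because this sum satisfies the recursion that defines the Chow function
(`uniformChowVal_rec`, `aeval_chow_top`).

With `k = m + 1` and `n = N + m + 1`, splitting `(n choose s)` turns the value into `∑_j (N+j choose
j) A_{m,j}` (`uniformChowVal_eq_sum`), where the family `A_{m,j}` does not depend on `N`. For `m ≥
1`, `A_{m,j}` is `(1+z)^m` times a polynomial in `u = z/(1+z)^2`, and these polynomials obey a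
simple recursion (`chowPart_eq_gammaVec`).

If `Im u > 0`, the recursion keeps the vectors sorted by argument inside a sector of angle `arg u <
π` (`Interlacing.step`), so a nonnegative combination that involves the first one cannot vanish. If
`u ≥ 0` is real, which is the case `|z| = 1`, all terms are nonnegative reals. Since `Im u` has the
sign of `Im z (1 - |z|^2)`, every non-real `z` or its conjugate is covered. -/

namespace ChowPoly

open Finset

/-! ### Cross products and vectors sorted in a sector of the plane. -/

/-- The cross product of two plane vectors: `cross x y = Im (y * conj x)`. -/
def cross (x y : ℂ) : ℝ := x.re * y.im - x.im * y.re

theorem cross_sum_left {ι : Type*} (s : Finset ι) (f : ι → ℂ) (y : ℂ) :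
    cross (∑ i ∈ s, f i) y = ∑ i ∈ s, cross (f i) y := by
  simp only [cross, Complex.re_sum, Complex.im_sum, Finset.sum_mul, Finset.sum_sub_distrib]

theorem cross_sum_right {ι : Type*} (s : Finset ι) (x : ℂ) (g : ι → ℂ) :
    cross x (∑ i ∈ s, g i) = ∑ i ∈ s, cross x (g i) := by
  simp only [cross, Complex.re_sum, Complex.im_sum, Finset.mul_sum, Finset.sum_sub_distrib]

theorem cross_sum_sum_nonneg {ι κ : Type*} {s : Finset ι} {t : Finset κ} {f : ι → ℂ} {g : κ → ℂ}
    (h : ∀ i ∈ s, ∀ j ∈ t, 0 ≤ cross (f i) (g j)) :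
    0 ≤ cross (∑ i ∈ s, f i) (∑ j ∈ t, g j) := by
  rw [cross_sum_left]
  refine Finset.sum_nonneg fun i hi => ?_
  rw [cross_sum_right]
  exact Finset.sum_nonneg fun j hj => h i hi j hj

theorem cross_sum_mul_sum_nonneg {ι κ : Type*} {s : Finset ι} {t : Finset κ} {f : ι → ℂ}
    {g : κ → ℂ} {u : ℂ} (h : ∀ i ∈ s, ∀ j ∈ t, 0 ≤ cross (f i) (u * g j)) :
    0 ≤ cross (∑ i ∈ s, f i) (u * ∑ j ∈ t, g j) := by
  rw [Finset.mul_sum]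
  exact cross_sum_sum_nonneg h

/-- If all `v j` lie in the cone spanned by `v 0` and `u * v 0`, with `Im u > 0`, then a
nonnegative combination of them that involves `v 0` does not vanish. -/
theorem sum_ne_zero_of_cross {u : ℂ} (hu : 0 < u.im) {m : ℕ} {v : ℕ → ℂ} {c : ℕ → ℝ}
    (hc : ∀ j, 0 ≤ c j) (hc0 : 0 < c 0) (h0 : v 0 ≠ 0)
    (h1 : ∀ j ≤ m, 0 ≤ cross (v 0) (v j)) (h2 : ∀ j ≤ m, 0 ≤ cross (v j) (u * v 0)) :
    ∑ j ∈ range (m + 1), (c j : ℂ) * v j ≠ 0 := by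
  intro hS
  set S := ∑ j ∈ range (m + 1), (c j : ℂ) * v j with hSdef
  -- The functional `S ↦ cross (v 0) S + cross S (u * v 0)` is real-linear, nonnegative on every `v
  -- j`, and equals `Im u * |v 0|^2 > 0` at `v 0`.
  have e : cross (v 0) S + cross S (u * v 0) =
      ∑ j ∈ range (m + 1), c j * (cross (v 0) (v j) + cross (v j) (u * v 0)) := by
    rw [hSdef, cross_sum_right, cross_sum_left, ← Finset.sum_add_distrib]
    refine Finset.sum_congr rfl fun j _ => ?_
    simp [cross]
    ring
  rw [hS, Finset.sum_range_succ'] at e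
  have h3 : 0 ≤ ∑ j ∈ range m, c (j + 1) * (cross (v 0) (v (j + 1)) +
      cross (v (j + 1)) (u * v 0)) := Finset.sum_nonneg fun j hj => by
    have hj' : j + 1 ≤ m := by simpa using hj
    exact mul_nonneg (hc _) (add_nonneg (h1 _ hj') (h2 _ hj'))
  have h4 : cross (v 0) (v 0) + cross (v 0) (u * v 0) = u.im * Complex.normSq (v 0) := by
    simp [cross, Complex.normSq_apply]
    ring
  have h5 : 0 < c 0 * (u.im * Complex.normSq (v 0)) :=
    mul_pos hc0 (mul_pos hu (Complex.normSq_pos.2 h0))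
  have h6 : cross (v 0) 0 + cross 0 (u * v 0) = 0 := by simp [cross]
  rw [h6, h4] at e
  linarith

/-- The interlacing pattern at a point `u` of the upper half-plane: the vectors `B i` are sorted by
argument within a sector of angle `arg u`, so are the vectors `B i + u * C i`, and the vectors
`C i`, `B j`, `u * C k` are in this order. -/
structure Interlacing (u : ℂ) (m : ℕ) (B C : ℕ → ℂ) : Prop where
  B_B : ∀ ⦃i j⦄, i ≤ j → j ≤ m → 0 ≤ cross (B i) (B j)
  B_uB : ∀ ⦃i j⦄, i ≤ j → j ≤ m → 0 ≤ cross (B j) (u * B i)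
  A_A : ∀ ⦃i j⦄, i ≤ j → j ≤ m → 0 ≤ cross (B i + u * C i) (B j + u * C j)
  A_uA : ∀ ⦃i j⦄, i ≤ j → j ≤ m → 0 ≤ cross (B j + u * C j) (u * (B i + u * C i))
  C_B : ∀ ⦃i j⦄, i ≤ m → j ≤ m → 0 ≤ cross (C i) (B j)
  B_uC : ∀ ⦃i j⦄, i ≤ m → j ≤ m → 0 ≤ cross (B i) (u * C j)

/-- Each required cross product expands bilinearly over initial, middle and final segments of the
index range. Antisymmetry cancels the common parts, `cross (u * x) (u * y) = |u|^2 * cross x y`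
removes double factors `u`, and every remaining term has a sign given by the pattern at level `m`.
-/
theorem Interlacing.step {u : ℂ} (hu : 0 ≤ u.im) {m : ℕ} {B C : ℕ → ℂ}
    (h : Interlacing u m B C) :
    Interlacing u (m + 1) (fun i => ∑ j ∈ Ico i (m + 1), (B j + u * C j))
      (fun i => ∑ j ∈ range i, B j) := by
  have hn : 0 ≤ u.re ^ 2 + u.im ^ 2 := by positivity
  have split : ∀ (f : ℕ → ℂ) {i k : ℕ}, i ≤ k → k ≤ m + 1 →
      ∑ j ∈ Ico i (m + 1), f j = ∑ j ∈ Ico i k, f j + ∑ j ∈ Ico k (m + 1), f j :=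
    fun f i k hik hk => (Finset.sum_Ico_consecutive f hik hk).symm
  have split' : ∀ (f : ℕ → ℂ) {i k : ℕ}, i ≤ k →
      ∑ j ∈ range k, f j = ∑ j ∈ range i, f j + ∑ j ∈ Ico i k, f j :=
    fun f i k hik => (Finset.sum_range_add_sum_Ico f hik).symm
  have sA : ∀ s : Finset ℕ, ∑ j ∈ s, (B j + u * C j) = ∑ j ∈ s, B j + u * ∑ j ∈ s, C j :=
    fun s => by rw [Finset.sum_add_distrib, Finset.mul_sum]
  -- comparisons of sums over initial, middle and final segments
  have bb : ∀ {s t : Finset ℕ}, (∀ i ∈ s, ∀ j ∈ t, i ≤ j ∧ j ≤ m) →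
      0 ≤ cross (∑ i ∈ s, B i) (∑ j ∈ t, B j) := fun hst =>
    cross_sum_sum_nonneg fun i hi j hj => h.B_B (hst i hi j hj).1 (hst i hi j hj).2
  have bub : ∀ {s t : Finset ℕ}, (∀ i ∈ s, ∀ j ∈ t, i ≤ j ∧ j ≤ m) →
      0 ≤ cross (∑ j ∈ t, B j) (u * ∑ i ∈ s, B i) := fun hst =>
    cross_sum_mul_sum_nonneg fun j hj i hi => h.B_uB (hst i hi j hj).1 (hst i hi j hj).2
  have aa : ∀ {s t : Finset ℕ}, (∀ i ∈ s, ∀ j ∈ t, i ≤ j ∧ j ≤ m) →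
      0 ≤ cross (∑ i ∈ s, (B i + u * C i)) (∑ j ∈ t, (B j + u * C j)) := fun hst =>
    cross_sum_sum_nonneg fun i hi j hj => h.A_A (hst i hi j hj).1 (hst i hi j hj).2
  have aua : ∀ {s t : Finset ℕ}, (∀ i ∈ s, ∀ j ∈ t, i ≤ j ∧ j ≤ m) →
      0 ≤ cross (∑ j ∈ t, (B j + u * C j)) (u * ∑ i ∈ s, (B i + u * C i)) := fun hst =>
    cross_sum_mul_sum_nonneg fun j hj i hi => h.A_uA (hst i hi j hj).1 (hst i hi j hj).2
  have cb : ∀ {s t : Finset ℕ}, (∀ i ∈ s, i ≤ m) → (∀ j ∈ t, j ≤ m) →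
      0 ≤ cross (∑ i ∈ s, C i) (∑ j ∈ t, B j) := fun hs ht =>
    cross_sum_sum_nonneg fun i hi j hj => h.C_B (hs i hi) (ht j hj)
  have buc : ∀ {s t : Finset ℕ}, (∀ i ∈ s, i ≤ m) → (∀ j ∈ t, j ≤ m) →
      0 ≤ cross (∑ i ∈ s, B i) (u * ∑ j ∈ t, C j) := fun hs ht =>
    cross_sum_mul_sum_nonneg fun i hi j hj => h.B_uC (hs i hi) (ht j hj)
  have auaSelf : ∀ v : ℂ, 0 ≤ cross v (u * v) := fun v => by
    have : cross v (u * v) = u.im * (v.re ^ 2 + v.im ^ 2) := by simp [cross]; ring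
    rw [this]; positivity
  constructor
  · intro i k hik hk
    rw [split _ hik hk]
    have h1 := aa (s := Ico i k) (t := Ico k (m + 1))
      (fun a ha b hb => by simp only [mem_Ico] at ha hb; omega)
    have e : ∀ x y : ℂ, cross (x + y) y = cross x y := fun x y => by simp [cross]; ring
    rwa [e]
  · intro i k hik hk
    rw [split _ hik hk]
    have h1 := aua (s := Ico i k) (t := Ico k (m + 1))
      (fun a ha b hb => by simp only [mem_Ico] at ha hb; omega)
    have e : ∀ x y : ℂ, cross y (u * (x + y)) = cross y (u * x) + cross y (u * y) :=
      fun x y => by simp [cross]; ring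
    rw [e]
    exact add_nonneg h1 (auaSelf _)
  · intro i k hik hk
    rw [split _ hik hk, split' _ hik]
    have r1 : ∀ a ∈ Ico i k, ∀ b ∈ Ico k (m + 1), a ≤ b ∧ b ≤ m := fun a ha b hb => by
      simp only [mem_Ico] at ha hb; omega
    have r2 : ∀ a ∈ range i, ∀ b ∈ Ico i k, a ≤ b ∧ b ≤ m := fun a ha b hb => by
      simp only [mem_Ico, mem_range] at ha hb; omega
    have r3 : ∀ a ∈ Ico i k, a ≤ m := fun a ha => by simp only [mem_Ico] at ha; omega
    have r4 : ∀ a ∈ Ico k (m + 1), a ≤ m := fun a ha => by simp only [mem_Ico] at ha; omega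
    have r5 : ∀ a ∈ range i, a ≤ m := fun a ha => by simp only [mem_range] at ha; omega
    have h1 := aa r1
    have h2 := bub r2
    have h3 := cb r3 r5
    have h4 := bub r1
    have h5 := cb r4 r3
    have h6 := bb r2
    have h7 := cb r3 r3
    have h8 := auaSelf (∑ j ∈ Ico i k, B j)
    simp only [sA] at h1 ⊢
    -- `T, T'` are the sums of `B, C` over the middle segment `[i, k)`, `P, P'` those over the tail
    -- from `k`, and `Q` is the sum of `B` before `i`. The common summand `P + u * P' + u * Q` of
    -- both arguments cancels against itself.
    generalize ∑ j ∈ Ico i k, B j = T at *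
    generalize ∑ j ∈ Ico i k, C j = T' at *
    generalize ∑ j ∈ Ico k (m + 1), B j = P at *
    generalize ∑ j ∈ Ico k (m + 1), C j = P' at *
    generalize ∑ j ∈ range i, B j = Q at *
    have e : cross (T + u * T' + (P + u * P') + u * Q) (P + u * P' + u * (Q + T)) =
        cross (T + u * T') (P + u * P') + cross T (u * Q) + cross P (u * T) + cross T (u * T)
        + (u.re ^ 2 + u.im ^ 2) * (cross T' Q + cross P' T + cross Q T + cross T' T) := by
      simp [cross]; ring
    rw [e]
    positivity
  · intro i k hik hk
    rw [split _ hik hk, split' _ hik]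
    have r1 : ∀ a ∈ Ico i k, ∀ b ∈ Ico k (m + 1), a ≤ b ∧ b ≤ m := fun a ha b hb => by
      simp only [mem_Ico] at ha hb; omega
    have r2 : ∀ a ∈ range i, ∀ b ∈ Ico i k, a ≤ b ∧ b ≤ m := fun a ha b hb => by
      simp only [mem_Ico, mem_range] at ha hb; omega
    have r3 : ∀ a ∈ Ico i k, a ≤ m := fun a ha => by simp only [mem_Ico] at ha; omega
    have r4 : ∀ a ∈ Ico k (m + 1), a ≤ m := fun a ha => by simp only [mem_Ico] at ha; omega
    have r5 : ∀ a ∈ range i, a ≤ m := fun a ha => by simp only [mem_range] at ha; omega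
    have h1 := aua r1
    have h2 := bb r2
    have h3 := buc r5 r3
    have h4 := bb r1
    have h5 := buc r3 r4
    have h6 := bub r2
    have h7 := buc r3 r3
    have h8 := auaSelf (∑ j ∈ Ico k (m + 1), (B j + u * C j) + u * ∑ j ∈ range i, B j)
    simp only [sA] at h1 h8 ⊢
    generalize ∑ j ∈ Ico i k, B j = T at *
    generalize ∑ j ∈ Ico i k, C j = T' at *
    generalize ∑ j ∈ Ico k (m + 1), B j = P at *
    generalize ∑ j ∈ Ico k (m + 1), C j = P' at *
    generalize ∑ j ∈ range i, B j = Q at *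
    have e : cross (P + u * P' + u * (Q + T)) (u * (T + u * T' + (P + u * P') + u * Q)) =
        cross (P + u * P' + u * Q) (u * (P + u * P' + u * Q))
        + cross (P + u * P') (u * (T + u * T'))
        + (u.re ^ 2 + u.im ^ 2) * (cross Q T + cross Q (u * T') + cross T P + cross T (u * P')
          + cross T (u * Q) + cross T (u * T')) := by
      simp [cross]; ring
    rw [e]
    positivity
  · intro i k hi hk
    have h1 : 0 ≤ cross (∑ j ∈ range i, B j) (∑ j ∈ Ico k (m + 1), B j) := by
      rcases le_total i k with hik | hik
      · exact bb fun a ha b hb => by simp only [mem_Ico, mem_range] at ha hb; omega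
      · rw [split' _ hik, split _ hik hi]
        have h1 := bb (s := range k) (t := Ico k i)
          fun a ha b hb => by simp only [mem_Ico, mem_range] at ha hb; omega
        have h2 := bb (s := range k) (t := Ico i (m + 1))
          fun a ha b hb => by simp only [mem_Ico, mem_range] at ha hb; omega
        have h3 := bb (s := Ico k i) (t := Ico i (m + 1))
          fun a ha b hb => by simp only [mem_Ico] at ha hb; omega
        have e : ∀ x y z : ℂ, cross (x + y) (y + z) = cross x y + cross x z + cross y z :=
          fun x y z => by simp [cross]; ring
        rw [e]
        positivity
    have h2 := buc (s := range i) (t := Ico k (m + 1))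
      (fun a ha => by simp only [mem_range] at ha; omega)
      (fun a ha => by simp only [mem_Ico] at ha; omega)
    rw [sA]
    have e : ∀ x y z : ℂ, cross x (y + z) = cross x y + cross x z :=
      fun x y z => by simp [cross]; ring
    rw [e]
    positivity
  · intro i k hi hk
    have h1 : 0 ≤ cross (∑ j ∈ Ico i (m + 1), B j) (u * ∑ j ∈ range k, B j) := by
      rcases le_total k i with hik | hik
      · exact bub fun a ha b hb => by simp only [mem_Ico, mem_range] at ha hb; omega
      · rw [split' _ hik, split _ hik hk]
        have h1 := bub (s := range i) (t := Ico i k)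
          fun a ha b hb => by simp only [mem_Ico, mem_range] at ha hb; omega
        have h2 := bub (s := range i) (t := Ico k (m + 1))
          fun a ha b hb => by simp only [mem_Ico, mem_range] at ha hb; omega
        have h3 := bub (s := Ico i k) (t := Ico k (m + 1))
          fun a ha b hb => by simp only [mem_Ico] at ha hb; omega
        have h4 := auaSelf (∑ j ∈ Ico i k, B j)
        have e : ∀ x y z : ℂ, cross (y + z) (u * (x + y)) =
            cross y (u * x) + cross z (u * x) + cross z (u * y) + cross y (u * y) :=
          fun x y z => by simp [cross]; ring
        rw [e]
        positivity
    have h2 := cb (s := Ico i (m + 1)) (t := range k)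
      (fun a ha => by simp only [mem_Ico] at ha; omega)
      (fun a ha => by simp only [mem_range] at ha; omega)
    rw [sA]
    have e : ∀ x y z : ℂ, cross (x + u * y) (u * z) =
        cross x (u * z) + (u.re ^ 2 + u.im ^ 2) * cross y z :=
      fun x y z => by simp [cross]; ring
    rw [e]
    positivity

/-! ### The recursive family in `u` and its nonvanishing combinations. -/

/-- The pair of families `(B_m, C_m)` (shifted by one in `m`) generated by
`B_{m+1,i} = ∑_{j ≥ i} (B_{m,j} + u C_{m,j})` and `C_{m+1,i} = ∑_{j < i} B_{m,j}`. -/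
noncomputable def gammaFamily (u : ℂ) : ℕ → (ℕ → ℂ) × (ℕ → ℂ)
  | 0 => (fun i => if i = 0 then 1 else 0, fun _ => 0)
  | m + 1 => (fun i => ∑ j ∈ Ico i (m + 2), ((gammaFamily u m).1 j + u * (gammaFamily u m).2 j),
      fun i => ∑ j ∈ range i, (gammaFamily u m).1 j)

/-- The vector `A = B + u C`. -/
noncomputable def gammaVec (u : ℂ) (m j : ℕ) : ℂ :=
  (gammaFamily u m).1 j + u * (gammaFamily u m).2 j

theorem gammaFamily_interlacing {u : ℂ} (hu : 0 ≤ u.im) (m : ℕ) :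
    Interlacing u (m + 1) (gammaFamily u m).1 (gammaFamily u m).2 := by
  induction m with
  | zero =>
    constructor <;> intro i j h1 h2 <;> simp only [gammaFamily] <;> split_ifs <;>
      simp [cross, hu]
  | succ m ih => exact ih.step hu

theorem gammaVec_zero_succ (u : ℂ) (m : ℕ) :
    gammaVec u (m + 1) 0 = ∑ j ∈ range (m + 2), gammaVec u m j := by
  simp [gammaVec, gammaFamily]

theorem sum_gammaVec_ne_zero {u : ℂ} (hu : 0 < u.im) {c : ℕ → ℝ} (hc : ∀ j, 0 ≤ c j)
    (hc0 : 0 < c 0) (m : ℕ) : ∑ j ∈ range (m + 2), (c j : ℂ) * gammaVec u m j ≠ 0 := by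
  have key : ∀ m, gammaVec u m 0 ≠ 0 → ∀ c : ℕ → ℝ, (∀ j, 0 ≤ c j) → 0 < c 0 →
      ∑ j ∈ range (m + 2), (c j : ℂ) * gammaVec u m j ≠ 0 := fun m h0 c hc hc0 =>
    sum_ne_zero_of_cross hu hc hc0 h0
      (fun j hj => (gammaFamily_interlacing hu.le m).A_A (Nat.zero_le j) hj)
      (fun j hj => (gammaFamily_interlacing hu.le m).A_uA (Nat.zero_le j) hj)
  -- The first vector at level `m + 1` is the sum of all vectors at level `m`, so it is nonzero by
  -- `key` with all coefficients `1`.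
  refine key m ?_ c hc hc0
  induction m with
  | zero => simp [gammaVec, gammaFamily]
  | succ m ih =>
    have := key m ih (fun _ => 1) (fun _ => zero_le_one) zero_lt_one
    rw [gammaVec_zero_succ]
    simpa using this

/-- For real `u` the sector argument loses strictness; positivity replaces it. -/
theorem gammaFamily_nonneg {x : ℝ} (hx : 0 ≤ x) (m j : ℕ) :
    ∃ b c : ℝ, 0 ≤ b ∧ 0 ≤ c ∧ (gammaFamily x m).1 j = b ∧ (gammaFamily x m).2 j = c := by
  induction m generalizing j with
  | zero => exact ⟨if j = 0 then 1 else 0, 0, by split_ifs <;> simp, le_rfl,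
      by simp only [gammaFamily]; split_ifs <;> simp, by simp [gammaFamily]⟩
  | succ m ih =>
    choose b c hb hc hB hC using ih
    refine ⟨∑ i ∈ Ico j (m + 2), (b i + x * c i), ∑ i ∈ range j, b i,
      Finset.sum_nonneg fun i _ => add_nonneg (hb i) (mul_nonneg hx (hc i)),
      Finset.sum_nonneg fun i _ => hb i, ?_, ?_⟩ <;> simp [gammaFamily, hB, hC]

theorem sum_gammaVec_ne_zero_of_nonneg {x : ℝ} (hx : 0 ≤ x) {c : ℕ → ℝ} (hc : ∀ j, 0 ≤ c j)
    (hc0 : 0 < c 0) (m : ℕ) : ∑ j ∈ range (m + 2), (c j : ℂ) * gammaVec x m j ≠ 0 := by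
  have ex : ∀ m j, ∃ a : ℝ, 0 ≤ a ∧ gammaVec x m j = a := fun m j => by
    obtain ⟨b, c, hb, hc, h1, h2⟩ := gammaFamily_nonneg hx m j
    exact ⟨b + x * c, by positivity, by simp [gammaVec, h1, h2]⟩
  choose a ha hA using ex
  have pos : ∀ m (c : ℕ → ℝ), 0 < a m 0 → (∀ j, 0 ≤ c j) → 0 < c 0 →
      0 < ∑ j ∈ range (m + 2), c j * a m j := fun m c h0 hc hc0 => by
    rw [Finset.sum_range_succ']
    exact add_pos_of_nonneg_of_pos
      (Finset.sum_nonneg fun j _ => mul_nonneg (hc _) (ha _ _)) (mul_pos hc0 h0)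
  have h0 : 0 < a m 0 := by
    induction m with
    | zero =>
      have := hA 0 0
      simp only [gammaVec, gammaFamily, if_true, mul_zero, add_zero] at this
      have : a 0 0 = 1 := by exact_mod_cast this.symm
      rw [this]; exact zero_lt_one
    | succ m ih =>
      have h1 := pos m (fun _ => 1) ih (fun _ => zero_le_one) zero_lt_one
      have h2 := gammaVec_zero_succ x m
      simp only [hA] at h2
      have h3 : a (m + 1) 0 = ∑ j ∈ range (m + 2), a m j := by exact_mod_cast h2
      rw [h3]
      simpa using h1
  have := (pos m c h0 hc hc0).ne'
  simp only [hA]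
  exact_mod_cast this

end ChowPoly

namespace ChowPoly

open Finset

/-! ### Derangement polynomials and their umbral identity. -/

/-- The derangement polynomials evaluated at `z`, given by
`d_n = z ∑_{s < n} (n choose s) d_s (1 + z + ⋯ + z^{n-2-s})` for `n > 0`. -/
noncomputable def derangementVal (z : ℂ) (n : ℕ) : ℂ :=
  if n = 0 then 1
  else z * ∑ s : Fin n, (n.choose s : ℂ) * derangementVal z s * ∑ i ∈ range (n - 1 - s), z ^ i

theorem derangementVal_zero (z : ℂ) : derangementVal z 0 = 1 := by simp [derangementVal]

theorem derangementVal_succ (z : ℂ) (n : ℕ) : derangementVal z (n + 1) =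
    z * ∑ s ∈ range (n + 1), ((n + 1).choose s : ℂ) * derangementVal z s *
      ∑ i ∈ range (n - s), z ^ i := by
  rw [derangementVal, if_neg n.succ_ne_zero, ← Fin.sum_univ_eq_sum_range
    (fun s => ((n + 1).choose s : ℂ) * derangementVal z s * ∑ i ∈ range (n - s), z ^ i)]
  simp

theorem sum_choose_mul_derangementVal (z : ℂ) (n : ℕ) :
    ∑ s ∈ range (n + 1), (n.choose s : ℂ) * derangementVal z s * (z ^ (n - s) - z) =
      if n = 0 then 1 - z else 0 := by
  rcases n with _ | n
  · simp [derangementVal_zero]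
  · rw [if_neg n.succ_ne_zero, Finset.sum_range_succ, Nat.choose_self, Nat.sub_self, pow_zero]
    -- For `s ≤ n` the factor `z^(n+1-s) - z` equals `z (z - 1) [n-s]`, so the recursion for
    -- `d_{n+1}` appears. The split-off term `s = n + 1` is `(1 - z) d_{n+1}` and cancels it.
    have h : ∑ s ∈ range (n + 1), ((n + 1).choose s : ℂ) * derangementVal z s *
        (z ^ (n + 1 - s) - z) = (z - 1) * derangementVal z (n + 1) := by
      rw [derangementVal_succ, Finset.mul_sum, Finset.mul_sum]
      refine Finset.sum_congr rfl fun s hs => ?_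
      have hs' : s ≤ n := by simpa [Nat.lt_succ_iff] using hs
      have := mul_geom_sum z (n - s)
      rw [show n + 1 - s = n - s + 1 by omega, pow_succ]
      linear_combination (-z * ((n + 1).choose s : ℂ) * derangementVal z s) * this
    rw [h]
    push_cast
    ring

/-- The linear functional `X ^ s ↦ d_s`. -/
noncomputable def derangementFunctional (z : ℂ) : Polynomial ℂ →ₗ[ℂ] ℂ :=
  Polynomial.lsum fun s => derangementVal z s • LinearMap.id

theorem derangementFunctional_X_add_C_pow (z a : ℂ) (n : ℕ) :
    derangementFunctional z ((Polynomial.X + Polynomial.C a) ^ n) =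
      ∑ s ∈ range (n + 1), (n.choose s : ℂ) * derangementVal z s * a ^ (n - s) := by
  rw [add_pow, map_sum]
  refine Finset.sum_congr rfl fun s _ => ?_
  have : (Polynomial.X ^ s * Polynomial.C a ^ (n - s) * (n.choose s : Polynomial ℂ)) =
      Polynomial.monomial s (a ^ (n - s) * (n.choose s : ℂ)) := by
    rw [← Polynomial.C_mul_X_pow_eq_monomial, Polynomial.C_mul, Polynomial.C_pow,
      Polynomial.C_eq_natCast]
    ring
  rw [this]
  simp [derangementFunctional, Polynomial.lsum_apply]
  ring

/-- On monomials this is `sum_choose_mul_derangementVal`; linearity makes it available for any `p`.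
-/
theorem derangementFunctional_comp (z : ℂ) (p : Polynomial ℂ) :
    derangementFunctional z (p.comp (Polynomial.X + Polynomial.C z)) -
      z * derangementFunctional z (p.comp (Polynomial.X + Polynomial.C 1)) =
      (1 - z) * p.eval 0 := by
  induction p using Polynomial.induction_on' with
  | add p q hp hq =>
    rw [Polynomial.add_comp, Polynomial.add_comp, map_add, map_add, Polynomial.eval_add]
    linear_combination hp + hq
  | monomial n a =>
    rw [Polynomial.monomial_comp, Polynomial.monomial_comp, ← Polynomial.smul_eq_C_mul,
      ← Polynomial.smul_eq_C_mul, map_smul, map_smul, derangementFunctional_X_add_C_pow,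
      derangementFunctional_X_add_C_pow]
    have h := sum_choose_mul_derangementVal z n
    simp only [mul_sub, Finset.sum_sub_distrib, ← Finset.sum_mul] at h
    simp only [one_pow, mul_one, smul_eq_mul, Polynomial.eval_monomial]
    have h2 : (0 : ℂ) ^ n * (1 - z) = if n = 0 then 1 - z else 0 := by
      split_ifs with h0 <;> simp [h0]
    linear_combination a * h - a * h2

/-- Take `p = (X - 1)^m` in `derangementFunctional_comp`: the two shifts become `(X + z - 1)^m` and
`X^m`. -/
theorem sum_choose_mul_pow_mul_derangementVal (z : ℂ) (m : ℕ) :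
    ∑ i ∈ range (m + 1), (m.choose i : ℂ) * (z - 1) ^ i * derangementVal z (m - i) =
      z * derangementVal z m + (-1) ^ m * (1 - z) := by
  have h := derangementFunctional_comp z ((Polynomial.X + Polynomial.C (-1)) ^ m)
  have e : ∀ a : ℂ, ((Polynomial.X + Polynomial.C (-1) : Polynomial ℂ) ^ m).comp
      (Polynomial.X + Polynomial.C a) = (Polynomial.X + Polynomial.C (a - 1)) ^ m := fun a => by
    simp only [Polynomial.pow_comp, Polynomial.add_comp, Polynomial.X_comp, Polynomial.C_comp]
    rw [add_assoc, ← Polynomial.C_add, sub_eq_add_neg]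
  rw [e, e, derangementFunctional_X_add_C_pow, derangementFunctional_X_add_C_pow,
    ← Finset.sum_range_reflect] at h
  have h1 : ∑ s ∈ range (m + 1), (m.choose s : ℂ) * derangementVal z s * (1 - 1) ^ (m - s) =
      derangementVal z m := by
    rw [Finset.sum_range_succ, Finset.sum_eq_zero]
    · simp
    · intro s hs
      have : m - s ≠ 0 := by simp only [mem_range] at hs; omega
      simp [this]
  rw [h1] at h
  have h2 : ∑ i ∈ range (m + 1), (m.choose i : ℂ) * (z - 1) ^ i * derangementVal z (m - i) =
      ∑ j ∈ range (m + 1), (m.choose (m + 1 - 1 - j) : ℂ) * derangementVal z (m + 1 - 1 - j) *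
        (z - 1) ^ (m - (m + 1 - 1 - j)) := by
    refine Finset.sum_congr rfl fun i hi => ?_
    have hi' : i ≤ m := by simpa [Nat.lt_succ_iff] using hi
    rw [Nat.add_sub_cancel, Nat.choose_symm hi', Nat.sub_sub_self hi']
    ring
  rw [h2]
  simp only [Polynomial.eval_pow, Polynomial.eval_add, Polynomial.eval_X, Polynomial.eval_C,
    zero_add] at h
  linear_combination h

/-! ### The closed form and its recursion. -/

/-- The value `∑_{s < K} (N choose s) d_s (1 + z + ⋯ + z^{K-1-s})` of the Chow polynomial of
`U_{K,N}` at `z`. -/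
noncomputable def uniformChowVal (z : ℂ) (K N : ℕ) : ℂ :=
  ∑ s ∈ range K, (N.choose s : ℂ) * derangementVal z s * ∑ i ∈ range (K - s), z ^ i

theorem sub_one_mul_uniformChowVal (z : ℂ) (K N : ℕ) : (z - 1) * uniformChowVal z K N =
    ∑ s ∈ range K, (N.choose s : ℂ) * derangementVal z s * (z ^ (K - s) - 1) := by
  rw [uniformChowVal, Finset.mul_sum]
  refine Finset.sum_congr rfl fun s _ => ?_
  rw [← mul_geom_sum]
  ring

/-- The recursion expressing that `uniformChowVal` inverts the reduced characteristic function. -/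
theorem uniformChowVal_rec {z : ℂ} (hz : z ≠ 1) {K N : ℕ} (hK : 0 < K) :
    (z - 1) * uniformChowVal z K N =
      ∑ i ∈ Ico 1 K, (N.choose i : ℂ) * ((z - 1) ^ i * uniformChowVal z (K - i) (N - i)) +
      ∑ i ∈ range K, (N.choose i : ℂ) * ((-1) ^ i * (z ^ (K - i) - 1)) := by
  -- Terms are collected by `m = i + s`. Since `(N choose i) (N-i choose m-i) = (N choose m) (m
  -- choose i)`, the inner sum is the umbral identity. Afterwards the term `i = 0` is moved across
  -- and a factor `z - 1` cancelled.
  have main : ∑ i ∈ range K, (N.choose i : ℂ) * ((z - 1) ^ i *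
      ((z - 1) * uniformChowVal z (K - i) (N - i))) =
      z * ((z - 1) * uniformChowVal z K N) +
        (1 - z) * ∑ i ∈ range K, (N.choose i : ℂ) * ((-1) ^ i * (z ^ (K - i) - 1)) := by
    simp only [sub_one_mul_uniformChowVal, Finset.mul_sum]
    rw [← Finset.sum_add_distrib]
    rw [← Finset.sum_range_diag_flip K (fun i s => (N.choose i : ℂ) * ((z - 1) ^ i *
      (((N - i).choose s : ℂ) * derangementVal z s * (z ^ (K - i - s) - 1))))]
    refine Finset.sum_congr rfl fun m hm => ?_
    have hm' : m < K := by simpa using hm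
    have h := sum_choose_mul_pow_mul_derangementVal z m
    trans (N.choose m : ℂ) * (z ^ (K - m) - 1) *
      ∑ i ∈ range (m + 1), (m.choose i : ℂ) * (z - 1) ^ i * derangementVal z (m - i)
    · rw [Finset.mul_sum]
      refine Finset.sum_congr rfl fun i hi => ?_
      have hi' : i ≤ m := by simpa [Nat.lt_succ_iff] using hi
      have hc : (N.choose m : ℂ) * m.choose i = N.choose i * (N - i).choose (m - i) := by
        exact_mod_cast Nat.choose_mul hi'
      rw [show K - i - (m - i) = K - m by omega]
      linear_combination (-(z - 1) ^ i * derangementVal z (m - i) * (z ^ (K - m) - 1)) * hc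
    · rw [h]; ring
  rw [Finset.range_eq_Ico, Finset.sum_eq_sum_Ico_succ_bot hK, ← Finset.range_eq_Ico] at main
  have hz' : z - 1 ≠ 0 := sub_ne_zero.2 hz
  apply mul_left_cancel₀ hz'
  have e : ∑ i ∈ Ico 1 K, (N.choose i : ℂ) * ((z - 1) ^ i *
      ((z - 1) * uniformChowVal z (K - i) (N - i))) = (z - 1) *
      ∑ i ∈ Ico 1 K, (N.choose i : ℂ) * ((z - 1) ^ i * uniformChowVal z (K - i) (N - i)) := by
    rw [Finset.mul_sum]
    exact Finset.sum_congr rfl fun i _ => by ring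
  rw [zero_add, e] at main
  simp only [Nat.choose_zero_right, Nat.cast_one, pow_zero, Nat.sub_zero, one_mul] at main
  linear_combination -main

/-! ### Binomial splitting and the expansion in `z/(1+z)^2`. -/

theorem sum_range_choose_sub_add (m r i : ℕ) (hi : i ≤ m + 1) :
    ∑ j ∈ range i, (m - j).choose r + (m + 1 - i).choose (r + 1) = (m + 1).choose (r + 1) := by
  induction i with
  | zero => simp
  | succ i ih =>
    have h := ih (by omega)
    rw [show m + 1 - i = (m - i) + 1 by omega, Nat.choose_succ_succ'] at h
    rw [Finset.sum_range_succ, show m + 1 - (i + 1) = m - i by omega]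
    omega

/-- Classify the subsets of size `N + r + 1` of `N + m + 1` points by their element number `N + 1`
in increasing order: if it sits at position `N + j + 1`, there are `(N+j choose j)` choices below it
and `(m-j choose r)` above. -/
theorem sum_range_choose_mul_choose (N m r : ℕ) :
    ∑ j ∈ range (m + 1), (N + j).choose j * (m - j).choose r =
      (N + m + 1).choose (N + r + 1) := by
  induction m generalizing r with
  | zero =>
    rcases r with _ | r
    · simp
    · simp [Nat.choose_eq_zero_of_lt (show N + 1 < N + (r + 1) + 1 by omega)]
  | succ m ih =>
    rw [Finset.sum_range_succ]
    rcases r with _ | r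
    · have h := ih 0
      simp only [Nat.choose_zero_right, mul_one, add_zero] at h ⊢
      rw [h, show N + (m + 1) + 1 = (N + m + 1) + 1 by omega, Nat.choose_succ_succ (N + m + 1) N,
        add_comm, ← Nat.choose_symm_of_eq_add (show N + (m + 1) = N + (m + 1) from rfl)]
      rfl
    · have h1 := ih r
      have h2 := ih (r + 1)
      rw [show N + (m + 1) + 1 = (N + m + 1) + 1 by omega,
        show N + (r + 1) + 1 = (N + r + 1) + 1 by omega, Nat.choose_succ_succ', ← h1,
        show N + r + 1 + 1 = N + (r + 1) + 1 by omega, ← h2, Nat.sub_self, Nat.choose_zero_succ,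
        mul_zero, add_zero, ← Finset.sum_add_distrib]
      refine Finset.sum_congr rfl fun j hj => ?_
      have hj' : j ≤ m := by simpa [Nat.lt_succ_iff] using hj
      rw [show m + 1 - j = (m - j) + 1 by omega, Nat.choose_succ_succ]
      ring

/-- `∑_s (m - j choose s - j) d_s (1 + z + ⋯ + z^{m-s})`. -/
noncomputable def chowPart (z : ℂ) (m j : ℕ) : ℂ :=
  ∑ s ∈ range (m + 1), ((m - j).choose (m - s) : ℂ) * derangementVal z s *
    ∑ i ∈ range (m + 1 - s), z ^ i

/-- `∑_s (m - j choose s - j) d_s (1 + z + ⋯ + z^{m-1-s})`. -/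
noncomputable def chowPart' (z : ℂ) (m j : ℕ) : ℂ :=
  ∑ s ∈ range (m + 1), ((m - j).choose (m - s) : ℂ) * derangementVal z s *
    ∑ i ∈ range (m - s), z ^ i

/-- All dependence on `N` moves into the positive coefficients. -/
theorem uniformChowVal_eq_sum (z : ℂ) (N m : ℕ) : uniformChowVal z (m + 1) (N + m + 1) =
    ∑ j ∈ range (m + 1), ((N + j).choose j : ℂ) * chowPart z m j := by
  simp only [chowPart, Finset.mul_sum (range (m + 1))]
  rw [Finset.sum_comm, uniformChowVal]
  refine Finset.sum_congr rfl fun s hs => ?_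
  have hs' : s ≤ m := by simpa [Nat.lt_succ_iff] using hs
  have h := sum_range_choose_mul_choose N m (m - s)
  rw [Nat.choose_symm_of_eq_add (show N + m + 1 = (N + (m - s) + 1) + s by omega)] at h
  rw [← h]
  push_cast
  rw [Finset.sum_mul, Finset.sum_mul]
  exact Finset.sum_congr rfl fun j _ => by ring

theorem chowPart'_succ (z : ℂ) (m i : ℕ) (hi : i ≤ m + 1) :
    chowPart' z (m + 1) i = ∑ j ∈ Ico i (m + 1), chowPart z m j := by
  simp only [chowPart]
  rw [Finset.sum_comm, chowPart', Finset.sum_range_succ]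
  simp only [Nat.sub_self, range_zero, sum_empty, mul_zero, add_zero]
  refine Finset.sum_congr rfl fun s hs => ?_
  have hs' : s ≤ m := by simpa [Nat.lt_succ_iff] using hs
  have h1 := sum_range_choose_sub_add m (m - s) i hi
  have h2 := sum_range_choose_sub_add m (m - s) (m + 1) le_rfl
  rw [← Finset.sum_range_add_sum_Ico _ hi, Nat.sub_self, Nat.choose_zero_succ] at h2
  have h3 : (m + 1 - i).choose (m + 1 - s) = ∑ j ∈ Ico i (m + 1), (m - j).choose (m - s) := by
    rw [show m + 1 - s = m - s + 1 by omega]; omega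
  rw [h3]
  push_cast
  rw [Finset.sum_mul, Finset.sum_mul]

/-- Two facts combine: `[r+2] = (1+z) [r+1] - z [r]`, and the top term `d_{m+1}` unfolds by its own
recursion. The difference of binomials left in front of `z d_s [m-s]` is a sum over `j < i` by the
hockey-stick identity. -/
theorem chowPart_succ (z : ℂ) (m i : ℕ) (hi : i ≤ m + 1) :
    chowPart z (m + 1) i =
      (1 + z) * chowPart' z (m + 1) i + z * ∑ j ∈ range i, chowPart' z m j := by
  have e : ∑ j ∈ range i, chowPart' z m j = ∑ s ∈ range (m + 1),
      (((m + 1).choose s : ℂ) - (m + 1 - i).choose (m + 1 - s)) * derangementVal z s *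
        ∑ i ∈ range (m - s), z ^ i := by
    simp only [chowPart']
    rw [Finset.sum_comm]
    refine Finset.sum_congr rfl fun s hs => ?_
    have hs' : s ≤ m := by simpa [Nat.lt_succ_iff] using hs
    have h1 := sum_range_choose_sub_add m (m - s) i hi
    rw [← Finset.sum_mul, ← Finset.sum_mul, show m + 1 - s = m - s + 1 by omega,
      Nat.choose_symm_of_eq_add (show m + 1 = s + (m - s + 1) by omega), ← h1]
    push_cast
    ring
  rw [e, chowPart', chowPart, Finset.sum_range_succ _ (m + 1), Finset.sum_range_succ _ (m + 1),
    Nat.sub_self,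
    show m + 1 + 1 - (m + 1) = 1 by omega, derangementVal_succ]
  simp only [range_zero, sum_empty, mul_zero, add_zero, Finset.sum_range_one, pow_zero, mul_one,
    Nat.choose_zero_right, Nat.cast_one, one_mul]
  rw [Finset.mul_sum (range (m + 1)), Finset.mul_sum (range (m + 1)),
    Finset.mul_sum (range (m + 1)), ← Finset.sum_add_distrib, ← Finset.sum_add_distrib]
  refine Finset.sum_congr rfl fun s hs => ?_
  have hs' : s ≤ m := by simpa [Nat.lt_succ_iff] using hs
  rw [show m + 1 + 1 - s = m - s + 1 + 1 by omega, show m + 1 - s = m - s + 1 by omega,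
    Finset.sum_range_succ, geom_sum_succ]
  have h := geom_sum_succ (x := z) (n := m - s)
  rw [Finset.sum_range_succ] at h
  generalize ∑ i ∈ range (m - s), z ^ i = G at *
  rw [pow_succ]
  linear_combination (((m + 1 - i).choose (m - s + 1) : ℂ) * derangementVal z s * z) * h

/-- In the recursion for `chowPart` the last sum carries two fewer powers of `1 + z` than the
result, so its factor `z` becomes `u = z/(1+z)^2`. -/
theorem chowPart_eq_gammaVec {z : ℂ} (hz : 1 + z ≠ 0) (m : ℕ) : ∀ j ≤ m + 1,
    chowPart' z (m + 1) j = (1 + z) ^ m * (gammaFamily (z / (1 + z) ^ 2) m).1 j ∧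
    chowPart z (m + 1) j = (1 + z) ^ (m + 1) * gammaVec (z / (1 + z) ^ 2) m j := by
  induction m with
  | zero =>
    intro j hj
    have hd : derangementVal z 1 = 0 := by simp [derangementVal_succ]
    interval_cases j <;>
      simp [chowPart, chowPart', gammaVec, gammaFamily, Finset.sum_range_succ, derangementVal_zero,
        hd]
  | succ m ih =>
    intro j hj
    have h1 : chowPart' z (m + 2) j =
        (1 + z) ^ (m + 1) * (gammaFamily (z / (1 + z) ^ 2) (m + 1)).1 j := by
      rw [chowPart'_succ z (m + 1) j hj, gammaFamily, Finset.mul_sum]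
      refine Finset.sum_congr rfl fun i hi => ?_
      exact (ih i (by simp only [mem_Ico] at hi; omega)).2
    refine ⟨h1, ?_⟩
    have h2 : ∑ i ∈ range j, chowPart' z (m + 1) i =
        (1 + z) ^ m * (gammaFamily (z / (1 + z) ^ 2) (m + 1)).2 j := by
      rw [gammaFamily, Finset.mul_sum]
      refine Finset.sum_congr rfl fun i hi => ?_
      exact (ih i (by simp only [mem_range] at hi; omega)).1
    rw [chowPart_succ z (m + 1) j hj, h1, h2, gammaVec]
    field_simp
    ring

theorem uniformChowVal_ne_zero {z : ℂ} (hz : z.im ≠ 0)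
    (hu : 0 ≤ z.im * (1 - Complex.normSq z)) {K N : ℕ} (hK : 0 < K) (hKN : K ≤ N) :
    uniformChowVal z K N ≠ 0 := by
  obtain ⟨m, rfl⟩ : ∃ m, K = m + 1 := ⟨K - 1, by omega⟩
  obtain ⟨M, rfl⟩ : ∃ M, N = M + m + 1 := ⟨N - (m + 1), by omega⟩
  rw [uniformChowVal_eq_sum]
  -- For `K = 1` the value is `1`; `gammaFamily` starts only at `K = 2`.
  rcases m with _ | m
  · simp [chowPart, derangementVal_zero]
  have hz1 : 1 + z ≠ 0 := fun h => hz (by simpa using congrArg Complex.im h)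
  have hq : 0 < Complex.normSq (1 + z) := Complex.normSq_pos.2 hz1
  set u := z / (1 + z) ^ 2 with hudef
  have hsplit : ∑ j ∈ range (m + 1 + 1), ((M + j).choose j : ℂ) * chowPart z (m + 1) j =
      (1 + z) ^ (m + 1) * ∑ j ∈ range (m + 2), (((M + j).choose j : ℝ) : ℂ) * gammaVec u m j := by
    rw [Finset.mul_sum]
    refine Finset.sum_congr rfl fun j hj => ?_
    rw [(chowPart_eq_gammaVec hz1 m j (by simpa [Nat.lt_succ_iff] using hj)).2]
    push_cast
    ring
  rw [hsplit]
  refine mul_ne_zero (pow_ne_zero _ hz1) ?_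
  have hu' : u = (z * (starRingEnd ℂ (1 + z)) ^ 2) / ((Complex.normSq (1 + z) ^ 2 : ℝ) : ℂ) := by
    have hc : starRingEnd ℂ (1 + z) ≠ 0 := (map_ne_zero _).2 hz1
    push_cast
    rw [hudef, ← Complex.mul_conj]
    field_simp
  have hre : u.re = (z.re * (1 + Complex.normSq z) + 2 * Complex.normSq z) /
      Complex.normSq (1 + z) ^ 2 := by
    rw [hu', Complex.div_ofReal_re]
    congr 1
    simp [pow_two, Complex.normSq_apply]
    ring
  have him : u.im = z.im * (1 - Complex.normSq z) / Complex.normSq (1 + z) ^ 2 := by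
    rw [hu', Complex.div_ofReal_im]
    congr 1
    simp [pow_two, Complex.normSq_apply]
    ring
  rcases hu.lt_or_eq with hlt | heq
  · exact sum_gammaVec_ne_zero (by rw [him]; positivity) (fun j => Nat.cast_nonneg _)
      (by simp) m
  -- On the unit circle `u` is real and the numerator of `Re u` is `2 (1 + Re z) ≥ 0`.
  · have hn : Complex.normSq z = 1 := by
      rcases mul_eq_zero.1 heq.symm with h | h
      · exact absurd h hz
      · linarith
    have hux : u = ((u.re : ℝ) : ℂ) := by
      apply Complex.ext
      · simp
      · rw [him, ← heq]; simp
    have hx : 0 ≤ u.re := by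
      rw [hre, hn]
      apply div_nonneg _ (by positivity)
      rw [Complex.normSq_apply] at hn
      nlinarith [sq_nonneg z.im]
    rw [hux]
    exact sum_gammaVec_ne_zero_of_nonneg hx (fun j => Nat.cast_nonneg _) (by simp) m

end ChowPoly

namespace ChowPoly

open Finset Polynomial

/-! ### Intervals of the uniform lattice and evaluation of its Chow function. -/

section Poset

variable {k n : ℕ}

theorem val_ne_univ {x : UniformLattice k n} (hx : x ≠ ⊤) : x.1 ≠ Finset.univ :=
  fun e => hx (Subtype.ext e)

theorem card_val_lt {x : UniformLattice k n} (hx : x ≠ ⊤) : x.1.card < min k n :=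
  (mem_uniformSet.1 x.2).resolve_right (val_ne_univ hx)

theorem grade_of_ne_top {x : UniformLattice k n} (hx : x ≠ ⊤) : grade ℕ x = x.1.card :=
  if_neg (val_ne_univ hx)

theorem grade_top_uniformLattice : grade ℕ (⊤ : UniformLattice k n) = min k n :=
  if_pos rfl

theorem sum_Icc_finset_apply_card {α M : Type*} [DecidableEq α] [AddCommMonoid M] {s t : Finset α}
    (hst : s ⊆ t) (f : ℕ → M) : ∑ r ∈ Icc s t, f (r.card - s.card) =
      ∑ i ∈ range (t.card - s.card + 1), (t.card - s.card).choose i • f i := by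
  have hd : ∀ r ∈ (t \ s).powerset, Disjoint s r := fun r hr =>
    Finset.disjoint_of_subset_right (Finset.mem_powerset.1 hr) Finset.disjoint_sdiff
  rw [Finset.Icc_eq_image_powerset hst, Finset.sum_image]
  · rw [← Finset.card_sdiff_of_subset hst, ← Finset.sum_powerset_apply_card]
    refine Finset.sum_congr rfl fun r hr => ?_
    rw [Finset.card_union_of_disjoint (hd r hr), Nat.add_sub_cancel_left]
  · intro a ha b hb hab
    have hab' : s ∪ a = s ∪ b := hab
    rw [← Finset.union_sdiff_cancel_left (hd a ha), hab',
      Finset.union_sdiff_cancel_left (hd b hb)]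

theorem sum_Icc_apply_card {M : Type*} [AddCommMonoid M] {x y : UniformLattice k n}
    (hxy : x ≤ y) (hy : y ≠ ⊤) (f : ℕ → M) : ∑ w ∈ Icc x y, f (w.1.card - x.1.card) =
      ∑ i ∈ range (y.1.card - x.1.card + 1), (y.1.card - x.1.card).choose i • f i := by
  rw [← sum_Icc_finset_apply_card hxy, Finset.subtype_Icc_eq,
    Finset.sum_subtype_of_mem (fun s : Finset (Fin n) => f (s.card - x.1.card))]
  intro s hs
  exact mem_uniformSet.2 (Or.inl ((Finset.card_le_card (Finset.mem_Icc.1 hs).2).trans_lt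
    (card_val_lt hy)))

/-- The proper elements above `x` are exactly the supersets of `x` with fewer than `k` elements, so
`f`, extended by zero, can be summed over a full Boolean interval. -/
theorem sum_Ico_top_apply_card {M : Type*} [AddCommMonoid M] {x : UniformLattice k n}
    (hx : x ≠ ⊤) (hkn : k ≤ n) (f : ℕ → M) : ∑ w ∈ Ico x ⊤, f (w.1.card - x.1.card) =
      ∑ i ∈ range (k - x.1.card), (n - x.1.card).choose i • f i := by
  have hxk := card_val_lt hx
  rw [min_eq_left hkn] at hxk
  have h1 : ∑ w ∈ Ico x ⊤, f (w.1.card - x.1.card) = ∑ s ∈ Icc x.1 Finset.univ,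
      if s.card - x.1.card < k - x.1.card then f (s.card - x.1.card) else 0 := by
    rw [← Finset.sum_filter, Finset.subtype_Ico_eq]
    refine Finset.sum_bij (fun w _ => w.1) ?_ (fun a _ b _ h => Subtype.ext h) ?_ fun _ _ => rfl
    · intro w hw
      rw [Finset.mem_subtype, Finset.mem_Ico] at hw
      have hw' : w ≠ ⊤ := fun e => hw.2.ne (congrArg Subtype.val e)
      have h2 := card_val_lt hw'
      rw [min_eq_left hkn] at h2
      exact Finset.mem_filter.2 ⟨Finset.mem_Icc.2 ⟨hw.1, hw.2.le⟩, by omega⟩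
    · intro s hs
      obtain ⟨hs1, hs2⟩ := Finset.mem_filter.1 hs
      have hs3 := (Finset.mem_Icc.1 hs1).1
      have hs4 : s.card < min k n := by
        have := Finset.card_le_card hs3
        rw [min_eq_left hkn]
        omega
      refine ⟨⟨s, mem_uniformSet.2 (Or.inl hs4)⟩, ?_, rfl⟩
      rw [Finset.mem_subtype, Finset.mem_Ico]
      refine ⟨hs3, lt_of_le_of_ne (Finset.subset_univ s) fun e => ?_⟩
      have e' : s = Finset.univ := e
      rw [e', Finset.card_univ, Fintype.card_fin] at hs4
      omega
  rw [h1, sum_Icc_finset_apply_card (Finset.subset_univ x.1)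
    (fun i => if i < k - x.1.card then f i else 0), Finset.card_univ, Fintype.card_fin]
  symm
  refine Finset.sum_subset_zero_on_sdiff (fun i hi => ?_) (fun i hi => ?_) fun i hi => ?_
  · simp only [Finset.mem_range] at hi ⊢; omega
  · simp only [Finset.mem_sdiff, Finset.mem_range] at hi
    rw [if_neg hi.2, smul_zero]
  · rw [if_pos (Finset.mem_range.1 hi)]

/-- The interval below a proper element is Boolean, since truncation only removes large sets. -/
theorem mu_of_ne_top {x y : UniformLattice k n} (hxy : x ≤ y) (hy : y ≠ ⊤) :
    IncidenceAlgebra.mu ℤ x y = (-1) ^ (y.1.card - x.1.card) := by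
  induction hd : y.1.card using Nat.strong_induction_on generalizing y with
  | _ d ih =>
  subst hd
  rcases hxy.eq_or_lt with rfl | hlt
  · simp [IncidenceAlgebra.mu_self]
  have h1 := IncidenceAlgebra.sum_Icc_mu_right (𝕜 := ℤ) x y
  have h2 := sum_Icc_apply_card hxy hy (fun i => (-1 : ℤ) ^ i)
  have hc : x.1.card < y.1.card := Finset.card_lt_card hlt
  simp only [nsmul_eq_mul] at h2
  rw [Finset.sum_congr rfl fun i _ => mul_comm _ _, Int.alternating_sum_range_choose,
    if_neg (by omega)] at h2
  rw [if_neg hlt.ne] at h1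
  rw [← Finset.Ico_insert_right hxy, Finset.sum_insert Finset.right_notMem_Ico] at h1 h2
  have h3 : ∑ w ∈ Ico x y, IncidenceAlgebra.mu ℤ x w =
      ∑ w ∈ Ico x y, (-1) ^ (w.1.card - x.1.card) := Finset.sum_congr rfl fun w hw => by
    have hw' := Finset.mem_Ico.1 hw
    exact ih w.1.card (Finset.card_lt_card hw'.2) hw'.1 (hw'.2.trans_le le_top).ne rfl
  linarith

theorem charFun_of_ne_top {x y : UniformLattice k n} (hxy : x ≤ y) (hy : y ≠ ⊤) :
    charFun x y = (X - 1 : ℤ[X]) ^ (y.1.card - x.1.card) := by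
  have hc := Finset.card_le_card (show x.1 ⊆ y.1 from hxy)
  trans ∑ w ∈ Icc x y, ((-1 : ℤ[X]) ^ (w.1.card - x.1.card) *
    X ^ (y.1.card - x.1.card - (w.1.card - x.1.card)))
  · refine Finset.sum_congr rfl fun w hw => ?_
    have hw' := Finset.mem_Icc.1 hw
    have hwt : w ≠ ⊤ := fun e => hy (top_le_iff.1 (e ▸ hw'.2))
    have h1 := Finset.card_le_card (show x.1 ⊆ w.1 from hw'.1)
    rw [mu_of_ne_top hw'.1 hwt, grade_of_ne_top hy, grade_of_ne_top hwt,
      show y.1.card - x.1.card - (w.1.card - x.1.card) = y.1.card - w.1.card by omega]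
    simp
  · rw [sum_Icc_apply_card hxy hy
      (fun i => (-1 : ℤ[X]) ^ i * X ^ (y.1.card - x.1.card - i)), sub_eq_neg_add, add_pow]
    exact Finset.sum_congr rfl fun i _ => by rw [nsmul_eq_mul]; ring

/-- The unknown `μ(x, ⊤)` is minus the sum of the other Möbius values, which puts the `-1` into each
factor. -/
theorem charFun_top {x : UniformLattice k n} (hx : x ≠ ⊤) (hkn : k ≤ n) :
    charFun x ⊤ = ∑ i ∈ range (k - x.1.card), (n - x.1.card).choose i •
      ((-1 : ℤ[X]) ^ i * (X ^ (k - x.1.card - i) - 1)) := by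
  have hmu := IncidenceAlgebra.sum_Icc_mu_right (𝕜 := ℤ) x ⊤
  rw [if_neg hx, ← Finset.Ico_insert_right le_top, Finset.sum_insert Finset.right_notMem_Ico]
    at hmu
  change ∑ w ∈ Icc x ⊤, C (IncidenceAlgebra.mu ℤ x w) *
    (X : ℤ[X]) ^ (grade ℕ (⊤ : UniformLattice k n) - grade ℕ w) = _
  rw [← Finset.Ico_insert_right le_top, Finset.sum_insert Finset.right_notMem_Ico,
    eq_neg_of_add_eq_zero_left hmu, Nat.sub_self, pow_zero, mul_one, C_neg, map_sum,
    neg_add_eq_sub, ← Finset.sum_sub_distrib, ← sum_Ico_top_apply_card hx hkn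
      (fun i => (-1 : ℤ[X]) ^ i * (X ^ (k - x.1.card - i) - 1))]
  refine Finset.sum_congr rfl fun w hw => ?_
  have hw' := Finset.mem_Ico.1 hw
  have h1 := Finset.card_le_card (show x.1 ⊆ w.1 from hw'.1)
  rw [mu_of_ne_top hw'.1 hw'.2.ne, grade_of_ne_top hw'.2.ne, grade_top_uniformLattice,
    min_eq_left hkn, show k - x.1.card - (w.1.card - x.1.card) = k - w.1.card by omega]
  simp [mul_sub]

theorem X_sub_one_mul_redCharFun {P : Type*} [PartialOrder P] [LocallyFiniteOrder P]
    [DecidableEq P] [GradeMinOrder ℕ P] {x y : P} (h : x ≠ y) :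
    (X - 1 : ℤ[X]) * redCharFun x y = charFun x y := by
  change (X - 1 : ℤ[X]) * (if x = y then -1 else charFun x y /ₘ (X - C 1)) = charFun x y
  rw [if_neg h, ← C_1]
  exact mul_divByMonic_eq_iff_isRoot.2 (dvd_iff_isRoot.1 (X_sub_one_dvd_charFun h))

theorem X_sub_one_mul_chow_top {P : Type*} [PartialOrder P] [OrderTop P] [LocallyFiniteOrder P]
    [DecidableEq P] [GradeMinOrder ℕ P] {x : P} (hx : x ≠ ⊤) :
    (X - 1 : ℤ[X]) * chow x ⊤ = ∑ w ∈ Ioo x ⊤, charFun x w * chow w ⊤ + charFun x ⊤ := by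
  have htop : chow (⊤ : P) ⊤ = (1 : ℤ[X]) := by rw [chow_apply, if_pos rfl]
  rw [chow_apply, if_neg hx, Finset.mul_sum, ← Finset.Ioo_insert_right (lt_top_iff_ne_top.2 hx),
    Finset.sum_insert Finset.right_notMem_Ioo, ← mul_assoc, X_sub_one_mul_redCharFun hx, htop,
    mul_one, add_comm]
  congr 1
  refine Finset.sum_congr rfl fun w hw => ?_
  rw [← mul_assoc, X_sub_one_mul_redCharFun (Finset.mem_Ioo.1 hw).1.ne]

/-- Only the sizes `k - |x|` and `n - |x|` enter the recursion over `[x, ⊤]`, and it is the one of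
`uniformChowVal_rec`; the induction is on `k - |x|`. -/
theorem aeval_chow_top {z : ℂ} (hz : z ≠ 1) (hkn : k ≤ n) {x : UniformLattice k n}
    (hx : x ≠ ⊤) : aeval z (chow x ⊤) = uniformChowVal z (k - x.1.card) (n - x.1.card) := by
  induction hd : k - x.1.card using Nat.strong_induction_on generalizing x with
  | _ d ih =>
  subst hd
  have hxk := card_val_lt hx
  rw [min_eq_left hkn] at hxk
  have hz' : z - 1 ≠ 0 := sub_ne_zero.2 hz
  apply mul_left_cancel₀ hz'
  have h1 := congrArg (aeval z) (X_sub_one_mul_chow_top hx)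
  rw [map_mul, map_sub, aeval_X, map_one] at h1
  rw [h1, uniformChowVal_rec hz (by omega), map_add, charFun_top hx hkn]
  congr 1
  · rw [map_sum]
    -- The value `0` at `i = 0` deletes the term `w = x`, leaving the open interval on one side and
    -- `1 ≤ i` on the other.
    have h2 := sum_Ico_top_apply_card hx hkn (fun i => if i = 0 then 0 else (z - 1) ^ i *
      uniformChowVal z (k - x.1.card - i) (n - x.1.card - i))
    rw [← Finset.Ioo_insert_left (lt_top_iff_ne_top.2 hx),
      Finset.sum_insert Finset.left_notMem_Ioo, Nat.sub_self, if_pos rfl, zero_add,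
      Finset.range_eq_Ico, Finset.sum_eq_sum_Ico_succ_bot (by omega), if_pos rfl, smul_zero,
      zero_add] at h2
    trans ∑ i ∈ Ioo x ⊤, if i.1.card - x.1.card = 0 then 0
      else (z - 1) ^ (i.1.card - x.1.card) * uniformChowVal z
        (k - x.1.card - (i.1.card - x.1.card)) (n - x.1.card - (i.1.card - x.1.card))
    · refine Finset.sum_congr rfl fun w hw => ?_
      have hw' := Finset.mem_Ioo.1 hw
      have hc : x.1.card < w.1.card := Finset.card_lt_card hw'.1
      have hwk := card_val_lt hw'.2.ne
      rw [if_neg (by omega), map_mul, charFun_of_ne_top hw'.1.le hw'.2.ne,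
        ih (k - w.1.card) (by omega) hw'.2.ne rfl,
        show k - x.1.card - (w.1.card - x.1.card) = k - w.1.card by omega,
        show n - x.1.card - (w.1.card - x.1.card) = n - w.1.card by omega]
      simp
    · rw [h2]
      refine Finset.sum_congr rfl fun i hi => ?_
      have hi' : i ≠ 0 := by simp only [Finset.mem_Ico] at hi; omega
      rw [if_neg hi', nsmul_eq_mul]
  · rw [map_sum]
    exact Finset.sum_congr rfl fun i _ => by simp

theorem aeval_chowPolynomial_uniformLattice {z : ℂ} (hz : z ≠ 1) (hk : 0 < k) (hkn : k ≤ n) :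
    aeval z (chowPolynomial (UniformLattice k n)) = uniformChowVal z k n := by
  have hb : (⊥ : UniformLattice k n).1 = ∅ := by
    change (dite _ _ _ : UniformLattice k n).1 = ∅
    rw [dif_pos (by omega)]
  have hbt : (⊥ : UniformLattice k n) ≠ ⊤ := fun e => by
    have h : (∅ : Finset (Fin n)) = Finset.univ := hb.symm.trans (congrArg Subtype.val e)
    have := congrArg Finset.card h
    simp only [Finset.card_empty, Finset.card_univ, Fintype.card_fin] at this
    omega
  have := aeval_chow_top hz hkn hbt
  rwa [hb, Finset.card_empty, Nat.sub_zero, Nat.sub_zero] at this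

theorem chowPolynomial_uniformLattice_zero : chowPolynomial (UniformLattice 0 n) = 1 := by
  have h : (⊥ : UniformLattice 0 n) = ⊤ := by
    change (dite _ _ _ : UniformLattice 0 n) = _
    rw [dif_neg (by simp)]
    rfl
  rw [chowPolynomial, chow_apply, if_pos h]

end Poset

end ChowPoly

/-- All complex zeros of the Chow polynomial of the uniform geometric lattice are real. -/
theorem theorem1p1 (k n : ℕ) (hkn : k ≤ n) :
    ∀ z : ℂ, Polynomial.aeval z (ChowPoly.chowPolynomial (ChowPoly.UniformLattice k n)) = 0 →
      z.im = 0 := by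
  intro z hz
  by_contra him
  rcases Nat.eq_zero_or_pos k with rfl | hk
  · rw [ChowPoly.chowPolynomial_uniformLattice_zero, map_one] at hz
    exact one_ne_zero hz
  have key : ∀ w : ℂ, w.im ≠ 0 → 0 ≤ w.im * (1 - Complex.normSq w) →
      Polynomial.aeval w (ChowPoly.chowPolynomial (ChowPoly.UniformLattice k n)) ≠ 0 :=
    fun w hw h => by
      rw [ChowPoly.aeval_chowPolynomial_uniformLattice (fun e => hw (by rw [e]; rfl)) hk hkn]
      exact ChowPoly.uniformChowVal_ne_zero hw h hk hkn
  rcases le_total 0 (z.im * (1 - Complex.normSq z)) with h | h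
  · exact key z him h hz
  -- Conjugation flips the sign of `Im z (1 - |z|^2)` and preserves zeros, the coefficients being
  -- integers.
  · refine key (starRingEnd ℂ z) (by simpa using him) ?_ ?_
    · rw [Complex.conj_im, Complex.normSq_conj]
      linarith
    · have := congrArg (starRingEnd ℂ) hz
      rwa [map_zero, Polynomial.aeval_def, Polynomial.hom_eval₂,
        RingHom.ext_int ((starRingEnd ℂ).comp (algebraMap ℤ ℂ)) (algebraMap ℤ ℂ)] at this
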